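/- Let $n$ agents share the cake $[0,1]$. A value density function is a piecewise constant $v:[0,1]\to\mathbb{R}_{\ge 0}$, i.e. there are $0=x_0<\dots<x_k=1$ such that $v$ is constant on each $(x_\ell,x_{\ell+1})$; put $V(S)=\int_S v(x)\,dx$. An allocation is a tuple $(A_1,\dots,A_n)$ of finite unions of closed subintervals of $[0,1]$ such that $A_i\cap A_j$ is a null set for $i\ne j$. For a profile $(v_1,\dots,v_n)$ it is proportional if $V_i(A_i)\ge\frac1n V_i([0,1])$ for all $i$, and Pareto-optimal if no allocation gives every agent $i$ at least $V_i(A_i)$ and some agent strictly more. A priority rule $\Gamma$ maps every profile of value density functions to a linear order of the agents. It is volatile if for all agents $i\ne j$, all orders $\pi,\pi'$, all value density functions $(v_k)_{k\notin\{i,j\}}$, every value density function $\bar v_j$ that is not identically zero, and all $v_i\ne v_i'$, there are $\alpha>0$ and $v_j=\alpha\bar v_j$ such that $\Gamma$ outputs $\pi$ on the profile formed by $(v_k)_{k\notin\{i,j\}},v_i,v_j$ and outputs $\pi'$ on the profile formed by $(v_k)_{k\notin\{i,j\}},v_i',v_j$. A priority mechanism for $\Gamma$ outputs, on each profile with $\Gamma$-order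 $\pi=(\pi_1,\dots,\pi_n)$, a proportional allocation that maximizes agent $\pi_1$'s value among all proportional allocations, subject to this maximizes agent $\pi_2$'s value, subject to both maximizes agent $\pi_3$'s value, and so on; ties are broken by an arbitrary deterministic rule. A mechanism $f$ is $k$-known-agents safely manipulable if there are an agent $i$, a set $K$ of $k$ other agents, reports $P_K$ for the agents in $K$, a true density $T_i$ and a report $P_i\ne T_i$ such that, with utilities measured by $T_i$, for all reports of the agents outside $K\cup\{i\}$ agent $i$ does at least as well under $f$ by reporting $P_i$ as by reporting $T_i$, and for some such reports she does strictly better. The RAT-degree of $f$ is the least $k$ for which $f$ is $k$-known-agents safely manipulable, or $n$ if there is none. Theorem. 1. A volatile priority rule exists. 2. For every priority rule $\Gamma$, a priority mechanism for $\Gamma$ exists (the successive maxima are attained), and every such mechanism always outputs a proportional and Pareto-optimal allocation. 3. If $n\ge 2$ and $\Gamma$ is volatile, then every priority mechanism for $\Gamma$ has RAT-degree exactly $n-1$. -/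

import Mathlib

open MeasureTheory

noncomputable section

/-! ### The RAT-degree of a mechanism

Agents `ι`, domains `D i` of preferences, outcomes `X`.  `u i T x` is the utility that agent `i`
derives from outcome `x` when her true preferences are `T`.  A mechanism is a function `f` from
reported profiles to outcomes. -/

namespace RAT

variable {ι X : Type*} [Fintype ι] [DecidableEq ι] {D : ι → Type*}

/-- Agent `i` has true preferences `T`; she knows the reports `PK` of the agents in `K`.
The report `P` is profitable given `K` and `PK`: some reports of the remaining agents
make `i` strictly better off reporting `P` than reporting `T`. -/
def ProfitableGiven (u : ∀ i, D i → X → ℝ) (f : (∀ i, D i) → X) (i : ι) (T P : D i)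
    (K : Finset ι) (PK : ∀ k : K, D k) : Prop :=
  ∃ Q : ∀ j, D j, (∀ k : K, Q k = PK k) ∧
    u i T (f (Function.update Q i T)) < u i T (f (Function.update Q i P))

/-- The report `P` is safe given `K` and `PK`: whatever the remaining agents report,
`i` weakly prefers the outcome of reporting `P` to the outcome of reporting `T`. -/
def SafeGiven (u : ∀ i, D i → X → ℝ) (f : (∀ i, D i) → X) (i : ι) (T P : D i)
    (K : Finset ι) (PK : ∀ k : K, D k) : Prop :=
  ∀ Q : ∀ j, D j, (∀ k : K, Q k = PK k) →
    u i T (f (Function.update Q i T)) ≤ u i T (f (Function.update Q i P))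

/-- The mechanism `f` is `k`-known-agents safely-manipulable. -/
def SafelyManipulable (u : ∀ i, D i → X → ℝ) (f : (∀ i, D i) → X) (k : ℕ) : Prop :=
  ∃ (i : ι) (K : Finset ι), i ∉ K ∧ K.card = k ∧ ∃ (PK : ∀ k : K, D k) (T P : D i),
    P ≠ T ∧ ProfitableGiven u f i T P K PK ∧ SafeGiven u f i T P K PK

open Classical in
/-- The RAT-degree: the minimum `k` for which `f` is `k`-known-agents safely-manipulable,
or the number of agents if there is no such `k`. -/
def ratDegree (u : ∀ i, D i → X → ℝ) (f : (∀ i, D i) → X) : ℕ :=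
  if h : ∃ k, SafelyManipulable u f k then Nat.find h else Fintype.card ι

end RAT

/-! ### Cake cutting

The cake is `unitInterval`, with Lebesgue measure `volume`; the agents are `Fin n`. -/

namespace Cake

/-- There are points `0 = x₀ < x₁ < ⋯ < x_k = 1` such that `v` is constant on every open interval
`(x_l, x_{l+1})`. -/
def IsPiecewiseConstant (v : unitInterval → ℝ) : Prop :=
  ∃ (k : ℕ) (x : Fin (k + 1) → unitInterval), StrictMono x ∧ x 0 = 0 ∧ x (Fin.last k) = 1 ∧
    ∀ l : Fin k, ∃ c : ℝ, ∀ y ∈ Set.Ioo (x l.castSucc) (x l.succ), v y = c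

/-- A (piecewise constant, nonnegative) value density function on the cake. -/
structure Density where
  toFun : unitInterval → ℝ
  nonneg : ∀ x, 0 ≤ toFun x
  piecewiseConstant : IsPiecewiseConstant toFun

/-- `V(S) = ∫_S v(x) dx`. -/
def Density.value (v : Density) (S : Set unitInterval) : ℝ :=
  ∫ x in S, v.toFun x

/-- A finite union of closed intervals.  (Overlapping or touching intervals can be merged, so such
a set is also a finite union of pairwise disjoint closed intervals.) -/
def IsFiniteUnionOfIntervals (S : Set unitInterval) : Prop :=
  ∃ F : Finset (unitInterval × unitInterval), S = ⋃ p ∈ F, Set.Icc p.1 p.2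

/-- An allocation of the cake: a share for each agent, any two of which overlap in a null set. -/
structure Allocation (n : ℕ) where
  share : Fin n → Set unitInterval
  isFiniteUnion : ∀ i, IsFiniteUnionOfIntervals (share i)
  inter_null : ∀ i j, i ≠ j → volume (share i ∩ share j) = 0

variable {n : ℕ}

/-- The utility of agent `i` with value density function `v` from an allocation. -/
def utility (i : Fin n) (v : Density) (A : Allocation n) : ℝ :=
  v.value (A.share i)

def IsProportional (v : Fin n → Density) (A : Allocation n) : Prop :=
  ∀ i, (1 / (n : ℝ)) * (v i).value Set.univ ≤ utility i (v i) A

def IsParetoOptimal (v : Fin n → Density) (A : Allocation n) : Prop :=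
  ¬ ∃ B : Allocation n, (∀ i, utility i (v i) A ≤ utility i (v i) B) ∧
    ∃ i, utility i (v i) A < utility i (v i) B

/-- A priority rule maps a profile to an order `π` of the agents; `π p` is the agent in
position `p`. -/
abbrev PriorityRule (n : ℕ) : Type := (Fin n → Density) → Equiv.Perm (Fin n)

/-- Volatility: by rescaling any given nonzero density `vbar`, agent `j` can make a change of
agent `i`'s report from `vi` to `vi'` change the order from any `π` to any `π'`.
Only the entries of `w` outside `{i, j}` matter. -/
def IsVolatile (Γ : PriorityRule n) : Prop :=
  ∀ i j : Fin n, i ≠ j → ∀ (π π' : Equiv.Perm (Fin n)) (w : Fin n → Density) (vbar : Density),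
    (∃ x, vbar.toFun x ≠ 0) → ∀ vi vi' : Density, vi ≠ vi' →
    ∃ vj : Density, (∃ α : ℝ, 0 < α ∧ ∀ x, vj.toFun x = α * vbar.toFun x) ∧
      Γ (Function.update (Function.update w i vi) j vj) = π ∧
      Γ (Function.update (Function.update w i vi') j vj) = π'

/-- The allocations that survive the first `k` rounds: initially all proportional ones; in the
next round, among the survivors, those that maximize the utility of the next agent in the order. -/
def leximaxStage (v : Fin n → Density) (π : Equiv.Perm (Fin n)) : ℕ → Set (Allocation n)
  | 0 => {A | IsProportional v A}
  | k + 1 => {A | A ∈ leximaxStage v π k ∧ ∀ hk : k < n, ∀ B ∈ leximaxStage v π k,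
      utility (π ⟨k, hk⟩) (v (π ⟨k, hk⟩)) B ≤ utility (π ⟨k, hk⟩) (v (π ⟨k, hk⟩)) A}

/-- `f` is a priority mechanism for `Γ`: on every profile it outputs an allocation that is leximax,
in the order given by `Γ`, among the proportional allocations (with any tie-breaking). -/
def IsPriorityMechanism (Γ : PriorityRule n) (f : (Fin n → Density) → Allocation n) : Prop :=
  ∀ v, f v ∈ leximaxStage v (Γ v) n

end Cake

end

/-!
On a common refinement of the breakpoints of finitely many piecewise constant densities (a `Grid`),
the utility of an agent is a linear function of the lengths that she receives in the cells. Every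
allocation divides these lengths, and conversely every division of the lengths among the agents is
realized by an allocation (`Allocation.exists_amount_eq`). So questions about allocations become
questions about the polytope of divisions.

In particular the set of attainable utility vectors is compact, and so is its part that survives
any round of the leximax procedure (`isCompact_image_leximaxStage`); hence the successive maxima
are attained. An allocation that Pareto-dominates a leximax one is again proportional and survives
all rounds, so that no agent can gain strictly (`isParetoOptimal_of_mem_leximaxStage`).

The RAT-degree rests on `exists_density_forall_utility_lt`. Let `i` value the cake positively, and
let `j` be interested only in an interval so small that every other agent regards it as at most an
`n`-th part of the cake, but which `i` wants. If `j` is first in the order, she takes the whole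
interval. If in the resulting allocation `i` still has a proportional share, let `j` hand over all
but an `n`-th part of her share: the result is proportional for the true density of `i`, so `i`
gets at least as much if she is first, which is strictly more than if `j` is first. Under a
volatile rule, one unknown agent `j` can thus make any misreport of `i` harmful, so that no
manipulation is safe with fewer than `n - 1` known agents. By the same token, an `i` who knows all
other reports can gain by doubling a uniform density, which changes nothing but the order.

A volatile rule exists (`exists_isVolatile`) because there are only continuum many densities: two
different reports of `i` have different real codes, hence are separated by a rational threshold.
The agent whose density has the largest maximum can therefore announce, through the integer part of
this maximum, an agent `i`, a threshold, and the order to be used on either side of it; by scaling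
her density she can make any such announcement.
-/

namespace Cake

/-! ### Grids and the division of their cells -/

/-- A subdivision `0 = x₀ < x₁ < ⋯ < x_m = 1` of the cake. -/
structure Grid where
  m : ℕ
  x : Fin (m + 1) → unitInterval
  strictMono : StrictMono x
  zero : x 0 = 0
  last : x (Fin.last m) = 1

namespace Grid

variable (G : Grid)

/-- The open cell between two consecutive points of the grid. -/
def cell (l : Fin G.m) : Set unitInterval := Set.Ioo (G.x l.castSucc) (G.x l.succ)

/-- The length of a cell. -/
def len (l : Fin G.m) : ℝ := (G.x l.succ : ℝ) - G.x l.castSucc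

theorem lt_succ (l : Fin G.m) : G.x l.castSucc < G.x l.succ := G.strictMono l.castSucc_lt_succ

theorem len_pos (l : Fin G.m) : 0 < G.len l := sub_pos.2 (G.lt_succ l)

theorem cell_nonempty (l : Fin G.m) : (G.cell l).Nonempty := Set.nonempty_Ioo.2 (G.lt_succ l)

/-- A sample point of a cell. -/
noncomputable def mid (l : Fin G.m) : unitInterval := (G.cell_nonempty l).some

theorem mid_mem (l : Fin G.m) : G.mid l ∈ G.cell l := (G.cell_nonempty l).some_mem

theorem measurableSet_cell (l : Fin G.m) : MeasurableSet (G.cell l) := measurableSet_Ioo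

theorem volume_real_cell (l : Fin G.m) : volume.real (G.cell l) = G.len l := by
  rw [measureReal_def, cell, unitInterval.volume_Ioo]
  exact ENNReal.toReal_ofReal (G.len_pos l).le

theorem x_succ_le {l l' : Fin G.m} (h : l < l') : G.x l.succ ≤ G.x l'.castSucc :=
  G.strictMono.monotone (Fin.le_def.2 (Nat.succ_le_of_lt (Fin.lt_def.1 h)))

theorem eq_of_mem_cell {l l' : Fin G.m} {y : unitInterval} (h : y ∈ G.cell l)
    (h' : y ∈ Set.Icc (G.x l'.castSucc) (G.x l'.succ)) : l = l' := by
  rcases lt_trichotomy l l' with hl | hl | hl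
  · exact absurd ((h.2.trans_le (G.x_succ_le hl)).trans_le h'.1) (lt_irrefl _)
  · exact hl
  · exact absurd ((h'.2.trans (G.x_succ_le hl)).trans_lt h.1) (lt_irrefl _)

theorem exists_mem_cell {y : unitInterval} (hy : y ∉ Set.range G.x) : ∃ l, y ∈ G.cell l := by
  by_contra! h
  have key : ∀ k : Fin (G.m + 1), G.x k < y := by
    intro k
    induction k using Fin.induction with
    | zero =>
      refine lt_of_le_of_ne (by rw [G.zero]; exact unitInterval.nonneg') fun e => hy ⟨_, e⟩
    | succ l ih =>
      refine lt_of_le_of_ne (not_lt.1 fun hlt => h l ⟨ih, hlt⟩) fun e => hy ⟨_, e⟩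
  have := key (Fin.last _)
  rw [G.last] at this
  exact absurd this (not_lt.2 unitInterval.le_one')

/-- A density is adapted to a grid if it is constant on each cell. -/
def Adapted (v : Density) : Prop := ∀ l, ∀ y ∈ G.cell l, v.toFun y = v.toFun (G.mid l)

/-- The value of a set is determined by the lengths of its traces on the cells of a grid. -/
theorem value_eq {v : Density} (hv : G.Adapted v) (S : Set unitInterval) :
    v.value S = ∑ l, v.toFun (G.mid l) * volume.real (S ∩ G.cell l) := by
  have hae : v.toFun =ᵐ[volume.restrict S]
      fun y => ∑ l, (G.cell l).indicator (fun _ => v.toFun (G.mid l)) y := by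
    apply ae_restrict_of_ae
    have : (Set.range G.x)ᶜ ∈ ae (volume : Measure unitInterval) :=
      compl_mem_ae_iff.2 ((Set.finite_range _).measure_zero _)
    filter_upwards [this] with y hy
    obtain ⟨l, hl⟩ := G.exists_mem_cell hy
    rw [Finset.sum_eq_single l]
    · rw [Set.indicator_of_mem hl, hv l y hl]
    · intro l' _ hne
      exact Set.indicator_of_notMem (fun h => hne (G.eq_of_mem_cell h ⟨hl.1.le, hl.2.le⟩)) _
    · simp
  rw [Density.value, integral_congr_ae hae, integral_finsetSum]
  · refine Finset.sum_congr rfl fun l _ => ?_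
    rw [setIntegral_indicator (G.measurableSet_cell l), setIntegral_const, smul_eq_mul, mul_comm]
  · intro l _
    exact (integrable_const _).indicator (G.measurableSet_cell l)

theorem value_univ {v : Density} (hv : G.Adapted v) :
    v.value Set.univ = ∑ l, v.toFun (G.mid l) * G.len l := by
  simp [G.value_eq hv, volume_real_cell]

theorem value_cell {v : Density} (hv : G.Adapted v) (l : Fin G.m) :
    v.toFun (G.mid l) * G.len l ≤ v.value Set.univ := by
  rw [G.value_univ hv]
  exact Finset.single_le_sum (f := fun l => v.toFun (G.mid l) * G.len l)
    (fun l _ => mul_nonneg (v.nonneg _) (G.len_pos l).le) (Finset.mem_univ l)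

/-- A finite set of points that contains both ends of the cake is the set of points of a grid. -/
theorem exists_range_eq (F : Finset unitInterval) (h0 : 0 ∈ F) (h1 : 1 ∈ F) :
    ∃ G : Grid, Set.range G.x = F := by
  obtain ⟨m, hm⟩ : ∃ m, F.card = m + 1 :=
    Nat.exists_eq_succ_of_ne_zero (Finset.card_ne_zero_of_mem h0)
  have hr : Set.range (F.orderEmbOfFin hm) = F := Finset.range_orderEmbOfFin F hm
  refine ⟨⟨m, F.orderEmbOfFin hm, (F.orderEmbOfFin hm).strictMono, ?_, ?_⟩, hr⟩
  · obtain ⟨k, hk⟩ : (0 : unitInterval) ∈ Set.range (F.orderEmbOfFin hm) := by rw [hr]; exact h0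
    refine le_antisymm ?_ unitInterval.nonneg'
    rw [← hk]
    exact (F.orderEmbOfFin hm).monotone (Fin.zero_le _)
  · obtain ⟨k, hk⟩ : (1 : unitInterval) ∈ Set.range (F.orderEmbOfFin hm) := by rw [hr]; exact h1
    refine le_antisymm unitInterval.le_one' ?_
    rw [← hk]
    exact (F.orderEmbOfFin hm).monotone (Fin.le_last _)

theorem Adapted.mono {G G' : Grid} (h : Set.range G.x ⊆ Set.range G'.x) {v : Density}
    (hv : G.Adapted v) : G'.Adapted v := by
  intro l y hy
  have hnot : ∀ z ∈ G'.cell l, z ∉ Set.range G.x := by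
    rintro z hz hz'
    obtain ⟨k, rfl⟩ := h hz'
    have h1 : l.castSucc < k := G'.strictMono.lt_iff_lt.1 hz.1
    have h2 : k < l.succ := G'.strictMono.lt_iff_lt.1 hz.2
    simp only [Fin.lt_def, Fin.val_castSucc, Fin.val_succ] at h1 h2
    omega
  obtain ⟨l', hl'⟩ := G.exists_mem_cell (hnot y hy)
  obtain ⟨l'', hl''⟩ := G.exists_mem_cell (hnot _ (G'.mid_mem l))
  have hout : ∀ k, G.x k ∉ G'.cell l := fun k hk => hnot _ hk ⟨k, rfl⟩
  have : G'.mid l ∈ G.cell l' := by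
    constructor
    · by_contra hc
      exact hout _ ⟨(G'.mid_mem l).1.trans_le (not_lt.1 hc), hl'.1.trans hy.2⟩
    · by_contra hc
      exact hout _ ⟨hy.1.trans hl'.2, (not_lt.1 hc).trans_lt (G'.mid_mem l).2⟩
  rw [hv l' y hl', hv l' _ this]

theorem exists_adapted (v : Density) : ∃ G : Grid, G.Adapted v := by
  obtain ⟨k, x, hx, h0, h1, hc⟩ := v.piecewiseConstant
  refine ⟨⟨k, x, hx, h0, h1⟩, fun l y hy => ?_⟩
  obtain ⟨c, hc⟩ := hc l
  rw [hc y hy, hc _ (mid_mem _ l)]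

/-- Finitely many densities are adapted to a common grid. -/
theorem exists_common {S : Set Density} (hS : S.Finite) : ∃ G : Grid, ∀ v ∈ S, G.Adapted v := by
  classical
  induction S, hS using Set.Finite.induction_on with
  | empty =>
    obtain ⟨G, -⟩ := exists_range_eq {0, 1} (by simp) (by simp)
    exact ⟨G, by simp⟩
  | @insert v S _ _ ih =>
    obtain ⟨G, hG⟩ := ih
    obtain ⟨G', hG'⟩ := exists_adapted v
    obtain ⟨H, hH⟩ := exists_range_eq (Finset.univ.image G.x ∪ Finset.univ.image G'.x)
      (by simpa using Or.inl ⟨0, G.zero⟩) (by simpa using Or.inl ⟨_, G.last⟩)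
    refine ⟨H, fun w hw => ?_⟩
    rcases hw with rfl | hw
    · exact hG'.mono (by rw [hH]; simp)
    · exact (hG w hw).mono (by rw [hH]; simp)

end Grid

theorem IsFiniteUnionOfIntervals.measurableSet {S : Set unitInterval}
    (h : IsFiniteUnionOfIntervals S) : MeasurableSet S := by
  obtain ⟨F, rfl⟩ := h
  exact F.measurableSet_biUnion fun _ _ => measurableSet_Icc

variable {n : ℕ}

namespace Allocation

theorem measurableSet_share (A : Allocation n) (i : Fin n) : MeasurableSet (A.share i) :=
  (A.isFiniteUnion i).measurableSet

/-- The length of the part of a cell that an agent receives. -/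
noncomputable def amount (A : Allocation n) (G : Grid) (i : Fin n) (l : Fin G.m) : ℝ :=
  volume.real (A.share i ∩ G.cell l)

theorem amount_nonneg (A : Allocation n) (G : Grid) (i : Fin n) (l : Fin G.m) :
    0 ≤ A.amount G i l := measureReal_nonneg

theorem sum_amount_le (A : Allocation n) (G : Grid) (l : Fin G.m) :
    ∑ i, A.amount G i l ≤ G.len l := by
  rw [← G.volume_real_cell]
  unfold amount
  rw [measureReal_def]
  simp_rw [measureReal_def]
  rw [← ENNReal.toReal_sum fun _ _ => measure_ne_top _ _]
  refine ENNReal.toReal_mono (measure_ne_top _ _) ?_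
  rw [← measure_biUnion_finset₀]
  · exact measure_mono (Set.iUnion₂_subset fun i _ => Set.inter_subset_right)
  · intro i _ j _ hij
    exact measure_mono_null (by intro y hy; exact ⟨hy.1.1, hy.2.1⟩) (A.inter_null i j hij)
  · intro i _
    exact ((A.measurableSet_share i).inter (G.measurableSet_cell l)).nullMeasurableSet

theorem amount_le (A : Allocation n) (G : Grid) (i : Fin n) (l : Fin G.m) :
    A.amount G i l ≤ G.len l :=
  (Finset.single_le_sum (fun i _ => A.amount_nonneg G i l) (Finset.mem_univ i)).trans
    (A.sum_amount_le G l)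

theorem utility_eq (A : Allocation n) {G : Grid} {v : Density} (hv : G.Adapted v) (i : Fin n) :
    utility i v A = ∑ l, v.toFun (G.mid l) * A.amount G i l :=
  G.value_eq hv _

/-- Any division of the lengths of the cells among the agents is realized by an allocation:
inside every cell, the agents receive consecutive intervals of the prescribed lengths. -/
theorem exists_amount_eq (G : Grid) (z : Fin n → Fin G.m → ℝ) (hz : ∀ i l, 0 ≤ z i l)
    (hs : ∀ l, ∑ i, z i l ≤ G.len l) : ∃ A : Allocation n, ∀ i l, A.amount G i l = z i l := by
  classical
  let s : Fin n → Fin G.m → ℝ := fun i l => G.x l.castSucc + ∑ k ∈ Finset.Iio i, z k l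
  let t : Fin n → Fin G.m → ℝ := fun i l => s i l + z i l
  have hxs : ∀ i l, (G.x l.castSucc : ℝ) ≤ s i l := fun i l =>
    le_add_of_nonneg_right (Finset.sum_nonneg fun k _ => hz k l)
  have hst : ∀ i l, s i l ≤ t i l := fun i l => le_add_of_nonneg_right (hz i l)
  have ht : ∀ i l, t i l = G.x l.castSucc + ∑ k ∈ Finset.Iic i, z k l := by
    intro i l
    have : Finset.Iic i = insert i (Finset.Iio i) := by
      ext k; simp [le_iff_eq_or_lt]
    rw [this, Finset.sum_insert (by simp)]
    simp only [t, s]; ring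
  have htx : ∀ i l, t i l ≤ G.x l.succ := by
    intro i l
    have h1 : ∑ k ∈ Finset.Iic i, z k l ≤ ∑ k, z k l :=
      Finset.sum_le_sum_of_subset_of_nonneg (Finset.subset_univ _) fun k _ _ => hz k l
    have h2 := hs l
    rw [ht]; unfold Grid.len at h2; linarith
  have hts : ∀ i j l, i < j → t i l ≤ s j l := by
    intro i j l hij
    have : ∑ k ∈ Finset.Iic i, z k l ≤ ∑ k ∈ Finset.Iio j, z k l :=
      Finset.sum_le_sum_of_subset_of_nonneg
        (fun k hk => Finset.mem_Iio.2 ((Finset.mem_Iic.1 hk).trans_lt hij)) fun k _ _ => hz k l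
    rw [ht]; simp only [s]; linarith
  have hs01 : ∀ i l, s i l ∈ unitInterval := fun i l =>
    ⟨(G.x _).2.1.trans (hxs i l), ((hst i l).trans (htx i l)).trans (G.x _).2.2⟩
  have ht01 : ∀ i l, t i l ∈ unitInterval := fun i l =>
    ⟨((G.x _).2.1.trans (hxs i l)).trans (hst i l), (htx i l).trans (G.x _).2.2⟩
  let σ : Fin n → Fin G.m → unitInterval := fun i l => ⟨s i l, hs01 i l⟩
  let τ : Fin n → Fin G.m → unitInterval := fun i l => ⟨t i l, ht01 i l⟩
  let share : Fin n → Set unitInterval := fun i => ⋃ l, Set.Icc (σ i l) (τ i l)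
  have hsub : ∀ i l, Set.Icc (σ i l) (τ i l) ⊆ Set.Icc (G.x l.castSucc) (G.x l.succ) :=
    fun i l => Set.Icc_subset_Icc (hxs i l) (htx i l)
  -- Two shares meet only in right end points of intervals and in points of the grid.
  have hnull : ∀ i j, i < j → volume (share i ∩ share j) = 0 := by
    intro i j hij
    refine measure_mono_null (t := Set.range (τ i) ∪ Set.range G.x) ?_
      (((Set.finite_range _).union (Set.finite_range _)).measure_zero _)
    rintro y ⟨h1, h2⟩
    obtain ⟨l, hl⟩ := Set.mem_iUnion.1 h1
    obtain ⟨l', hl'⟩ := Set.mem_iUnion.1 h2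
    rcases lt_trichotomy l l' with h | rfl | h
    · refine Or.inr ⟨l.succ, le_antisymm ?_ (hsub i l hl).2⟩
      exact (G.x_succ_le h).trans (hsub j l' hl').1
    · exact Or.inl ⟨l, le_antisymm ((show τ i l ≤ σ j l from hts i j l hij).trans hl'.1) hl.2⟩
    · refine Or.inr ⟨l'.succ, le_antisymm ?_ (hsub j l' hl').2⟩
      exact (G.x_succ_le h).trans (hsub i l hl).1
  refine ⟨⟨share, fun i => ⟨Finset.univ.image fun l => (σ i l, τ i l), by simp [share]⟩, ?_⟩, ?_⟩
  · intro i j hij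
    rcases lt_or_gt_of_ne hij with h | h
    · exact hnull i j h
    · rw [Set.inter_comm]; exact hnull j i h
  · intro i l
    have hlen : (τ i l : ℝ) - σ i l = z i l := by simp [τ, σ, t]
    have hvol : volume (share i ∩ G.cell l) = ENNReal.ofReal (τ i l - σ i l) := by
      apply le_antisymm
      · rw [← unitInterval.volume_Icc]
        refine measure_mono fun y hy => ?_
        obtain ⟨l', hl'⟩ := Set.mem_iUnion.1 hy.1
        rwa [G.eq_of_mem_cell hy.2 (hsub i l' hl')]
      · rw [← unitInterval.volume_Ioo]
        refine measure_mono fun y hy => ⟨Set.mem_iUnion.2 ⟨l, hy.1.le, hy.2.le⟩, ?_, ?_⟩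
        · exact lt_of_le_of_lt (hxs i l) hy.1
        · exact lt_of_lt_of_le hy.2 (htx i l)
    rw [amount, measureReal_def, hvol, hlen, ENNReal.toReal_ofReal (hz i l)]

end Allocation

/-! ### Existence and Pareto-optimality of leximax allocations -/

/-- The vector of utilities that an allocation gives to the agents of a profile. -/
noncomputable def utilityVector (v : Fin n → Density) (A : Allocation n) (i : Fin n) : ℝ :=
  utility i (v i) A

theorem isCompact_range_utilityVector (v : Fin n → Density) :
    IsCompact (Set.range (utilityVector v)) := by
  obtain ⟨G, hG⟩ := Grid.exists_common (Set.finite_range v)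
  let Z : Set (Fin n → Fin G.m → ℝ) :=
    {z | (∀ i l, 0 ≤ z i l) ∧ ∀ l, ∑ i, z i l ≤ G.len l}
  have hZ : IsCompact Z := by
    have hclosed : IsClosed Z := by
      refine IsClosed.inter (s₁ := {z : Fin n → Fin G.m → ℝ | ∀ i l, 0 ≤ z i l})
        (s₂ := {z : Fin n → Fin G.m → ℝ | ∀ l, ∑ i, z i l ≤ G.len l}) ?_ ?_
      · simp only [Set.ofPred_forall]
        exact isClosed_iInter fun i => isClosed_iInter fun l =>
          isClosed_le continuous_const (by fun_prop)
      · simp only [Set.ofPred_forall]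
        exact isClosed_iInter fun l => isClosed_le (by fun_prop) continuous_const
    refine IsCompact.of_isClosed_subset
      (isCompact_Icc (a := (0 : Fin n → Fin G.m → ℝ)) (b := fun _ l => G.len l)) hclosed ?_
    exact fun z hz => ⟨fun i l => hz.1 i l, fun i l =>
      (Finset.single_le_sum (fun i _ => hz.1 i l) (Finset.mem_univ i)).trans (hz.2 l)⟩
  have himg : Set.range (utilityVector v) =
      (fun z : Fin n → Fin G.m → ℝ => fun i => ∑ l, (v i).toFun (G.mid l) * z i l) '' Z := by
    apply Set.Subset.antisymm
    · rintro _ ⟨A, rfl⟩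
      exact ⟨A.amount G, ⟨A.amount_nonneg G, A.sum_amount_le G⟩,
        funext fun i => (A.utility_eq (hG _ ⟨i, rfl⟩) i).symm⟩
    · rintro _ ⟨z, hz, rfl⟩
      obtain ⟨A, hA⟩ := Allocation.exists_amount_eq G z hz.1 hz.2
      refine ⟨A, funext fun i => ?_⟩
      simp only [utilityVector, A.utility_eq (hG _ ⟨i, rfl⟩) i, hA]
  rw [himg]
  exact hZ.image (by fun_prop)

theorem exists_isProportional (v : Fin n → Density) : ∃ A, IsProportional v A := by
  obtain ⟨G, hG⟩ := Grid.exists_common (Set.finite_range v)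
  obtain ⟨A, hA⟩ := Allocation.exists_amount_eq G (fun (_ : Fin n) l => 1 / (n : ℝ) * G.len l)
    (fun _ l => mul_nonneg (by positivity) (G.len_pos l).le) fun l => by
      rcases Nat.eq_zero_or_pos n with rfl | hn
      · simpa using (G.len_pos l).le
      · have : (n : ℝ) ≠ 0 := by positivity
        simp [this]
  refine ⟨A, fun i => le_of_eq ?_⟩
  rw [A.utility_eq (hG _ ⟨i, rfl⟩), G.value_univ (hG _ ⟨i, rfl⟩), Finset.mul_sum]
  exact Finset.sum_congr rfl fun l _ => by rw [hA]; ring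

/-- Every round of the leximax procedure has a compact nonempty set of utility vectors, so that
the maximum of the next round is attained. -/
theorem isCompact_image_leximaxStage (v : Fin n → Density) (π : Equiv.Perm (Fin n)) (k : ℕ) :
    IsCompact (utilityVector v '' leximaxStage v π k) ∧
      (utilityVector v '' leximaxStage v π k).Nonempty := by
  induction k with
  | zero =>
    constructor
    · have : utilityVector v '' leximaxStage v π 0 = Set.range (utilityVector v) ∩
          {u | ∀ i, (1 / (n : ℝ)) * (v i).value Set.univ ≤ u i} := by
        apply Set.Subset.antisymm
        · rintro _ ⟨A, hA, rfl⟩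
          exact ⟨⟨A, rfl⟩, hA⟩
        · rintro _ ⟨⟨A, rfl⟩, hA⟩
          exact ⟨A, hA, rfl⟩
      rw [this]
      refine (isCompact_range_utilityVector v).inter_right ?_
      simp only [Set.ofPred_forall]
      exact isClosed_iInter fun i => isClosed_le continuous_const (by fun_prop)
    · obtain ⟨A, hA⟩ := exists_isProportional v
      exact ⟨_, A, hA, rfl⟩
  | succ k ih =>
    obtain ⟨hc, hne⟩ := ih
    set C := utilityVector v '' leximaxStage v π k with hC
    have himg : utilityVector v '' leximaxStage v π (k + 1) =
        C ∩ {u | ∀ hk : k < n, ∀ w ∈ C, w (π ⟨k, hk⟩) ≤ u (π ⟨k, hk⟩)} := by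
      apply Set.Subset.antisymm
      · rintro _ ⟨A, hA, rfl⟩
        refine ⟨⟨A, hA.1, rfl⟩, ?_⟩
        rintro hk _ ⟨B, hB, rfl⟩
        exact hA.2 hk B hB
      · rintro _ ⟨⟨A, hA, rfl⟩, h⟩
        exact ⟨A, ⟨hA, fun hk B hB => h hk _ ⟨B, hB, rfl⟩⟩, rfl⟩
    rw [himg]
    constructor
    · refine hc.inter_right ?_
      simp only [Set.ofPred_forall]
      exact isClosed_iInter fun hk => isClosed_iInter fun w => isClosed_iInter fun _ =>
        isClosed_le continuous_const (by fun_prop)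
    · by_cases hk : k < n
      · obtain ⟨u, hu, hmax⟩ := hc.exists_isMaxOn hne
          (f := fun u : Fin n → ℝ => u (π ⟨k, hk⟩)) (by fun_prop)
        exact ⟨u, hu, fun _ w hw => hmax hw⟩
      · obtain ⟨u, hu⟩ := hne
        exact ⟨u, hu, fun hk' => absurd hk' hk⟩

theorem exists_isPriorityMechanism (Γ : PriorityRule n) :
    ∃ f : (Fin n → Density) → Allocation n, IsPriorityMechanism Γ f := by
  have h : ∀ v, ∃ A, A ∈ leximaxStage v (Γ v) n := fun v =>
    (isCompact_image_leximaxStage v (Γ v) n).2.of_image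
  choose f hf using h
  exact ⟨f, hf⟩

theorem leximaxStage_antitone (v : Fin n → Density) (π : Equiv.Perm (Fin n)) :
    Antitone (leximaxStage v π) :=
  antitone_nat_of_succ_le fun _ _ hA => hA.1

theorem isProportional_of_mem_leximaxStage {v : Fin n → Density} {π : Equiv.Perm (Fin n)}
    {A : Allocation n} {k : ℕ} (hA : A ∈ leximaxStage v π k) : IsProportional v A :=
  leximaxStage_antitone v π (Nat.zero_le k) hA

/-- An allocation that dominates a leximax one is proportional and survives every round, hence
gives no agent more in the round in which she is maximized. -/
theorem isParetoOptimal_of_mem_leximaxStage {v : Fin n → Density} {π : Equiv.Perm (Fin n)}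
    {A : Allocation n} (hA : A ∈ leximaxStage v π n) : IsParetoOptimal v A := by
  rintro ⟨B, hB, i, hi⟩
  have key : ∀ k ≤ n, B ∈ leximaxStage v π k := by
    intro k
    induction k with
    | zero => exact fun _ p => (isProportional_of_mem_leximaxStage hA p).trans (hB p)
    | succ k ih =>
      intro hk
      refine ⟨ih (Nat.le_of_succ_le hk), fun hk' C hC => ?_⟩
      exact ((leximaxStage_antitone v π hk hA).2 hk' C hC).trans (hB _)
  obtain ⟨p, rfl⟩ := π.surjective i
  exact absurd ((leximaxStage_antitone v π p.2 hA).2 p.2 B (key p p.2.le)) (not_le.2 hi)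

/-- The first agent in the order receives the maximum over all proportional allocations. -/
theorem utility_le_of_first {v : Fin n → Density} {π : Equiv.Perm (Fin n)} {A B : Allocation n}
    (hn : 0 < n) {i : Fin n} (hi : π ⟨0, hn⟩ = i) (hA : A ∈ leximaxStage v π n)
    (hB : IsProportional v B) : utility i (v i) B ≤ utility i (v i) A := by
  subst hi
  exact (leximaxStage_antitone v π (show 1 ≤ n from hn) hA).2 hn B hB

/-! ### The effect of the priority order on an agent's utility -/

theorem Density.value_nonneg (v : Density) (S : Set unitInterval) : 0 ≤ v.value S :=
  integral_nonneg v.nonneg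

theorem Density.value_le_univ (v : Density) (S : Set unitInterval) :
    v.value S ≤ v.value Set.univ := by
  obtain ⟨G, hG⟩ := Grid.exists_adapted v
  rw [G.value_eq hG, G.value_univ hG]
  refine Finset.sum_le_sum fun l _ => mul_le_mul_of_nonneg_left ?_ (v.nonneg _)
  rw [← G.volume_real_cell]
  exact measureReal_mono Set.inter_subset_right

theorem Density.value_of_eq_mul {v w : Density} {c : ℝ} (h : ∀ x, v.toFun x = c * w.toFun x)
    (S : Set unitInterval) : v.value S = c * w.value S := by
  simp only [Density.value, h, integral_const_mul]

namespace Grid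

variable (G : Grid)

theorem x_lt_iff {l : Fin G.m} {y : unitInterval} (hy : y ∈ G.cell l) (k : Fin (G.m + 1)) :
    G.x k < y ↔ k ≤ l.castSucc := by
  constructor
  · intro h
    have := G.strictMono.lt_iff_lt.1 (h.trans hy.2)
    rw [Fin.lt_def, Fin.val_succ] at this
    exact Fin.le_def.2 (Nat.lt_succ_iff.1 this)
  · exact fun h => (G.strictMono.monotone h).trans_lt hy.1

theorem lt_x_iff {l : Fin G.m} {y : unitInterval} (hy : y ∈ G.cell l) (k : Fin (G.m + 1)) :
    y < G.x k ↔ l.succ ≤ k := by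
  constructor
  · intro h
    have := G.strictMono.lt_iff_lt.1 (hy.1.trans h)
    rw [Fin.lt_def, Fin.val_castSucc] at this
    exact Fin.le_def.2 (by rw [Fin.val_succ]; exact this)
  · exact fun h => hy.2.trans_le (G.strictMono.monotone h)

end Grid

/-- The indicator function of an open interval, as a density. -/
noncomputable def Density.indicatorIoo (a b : unitInterval) : Density where
  toFun := (Set.Ioo a b).indicator 1
  nonneg := Set.indicator_nonneg fun _ _ => zero_le_one
  piecewiseConstant := by
    classical
    obtain ⟨G, hG⟩ := Grid.exists_range_eq {0, a, b, 1} (by simp) (by simp)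
    refine ⟨G.m, G.x, G.strictMono, G.zero, G.last, fun l =>
      ⟨(Set.Ioo a b).indicator 1 (G.mid l), fun y hy => ?_⟩⟩
    obtain ⟨ka, ha⟩ : a ∈ Set.range G.x := by rw [hG]; simp
    obtain ⟨kb, hb⟩ : b ∈ Set.range G.x := by rw [hG]; simp
    have : y ∈ Set.Ioo a b ↔ G.mid l ∈ Set.Ioo a b := by
      rw [Set.mem_Ioo, Set.mem_Ioo, ← ha, ← hb, G.x_lt_iff hy, G.x_lt_iff (G.mid_mem l),
        G.lt_x_iff hy, G.lt_x_iff (G.mid_mem l)]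
    by_cases h : y ∈ Set.Ioo a b
    · rw [Set.indicator_of_mem h, Set.indicator_of_mem (this.1 h)]; rfl
    · rw [Set.indicator_of_notMem h, Set.indicator_of_notMem (mt this.2 h)]

/-- A constant density. -/
def Density.const (c : ℝ) (hc : 0 ≤ c) : Density where
  toFun _ := c
  nonneg _ := hc
  piecewiseConstant := by
    obtain ⟨G, -⟩ := Grid.exists_range_eq {0, 1} (by simp) (by simp)
    exact ⟨G.m, G.x, G.strictMono, G.zero, G.last, fun _ => ⟨c, fun _ _ => rfl⟩⟩

/-- The value of an interval in terms of a grid to which its indicator is adapted. -/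
theorem Grid.value_Ioo (G : Grid) {v : Density} (hv : G.Adapted v) {a b : unitInterval}
    (hab : G.Adapted (.indicatorIoo a b)) :
    v.value (Set.Ioo a b) =
      ∑ l, v.toFun (G.mid l) * ((Density.indicatorIoo a b).toFun (G.mid l) * G.len l) := by
  rw [G.value_eq hv]
  refine Finset.sum_congr rfl fun l _ => ?_
  congr 1
  by_cases h : G.mid l ∈ Set.Ioo a b
  · have h1 : Set.Ioo a b ∩ G.cell l = G.cell l := by
      refine Set.inter_eq_right.2 fun y hy => ?_
      by_contra hy'
      have := hab l y hy
      simp [Density.indicatorIoo, Set.indicator_of_mem h, Set.indicator_of_notMem hy'] at this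
    rw [h1, G.volume_real_cell]
    simp [Density.indicatorIoo, Set.indicator_of_mem h]
  · have h1 : Set.Ioo a b ∩ G.cell l = ∅ := by
      refine Set.eq_empty_of_forall_notMem fun y hy => ?_
      have := hab l y hy.2
      simp [Density.indicatorIoo, Set.indicator_of_mem hy.1, Set.indicator_of_notMem h] at this
    rw [h1]
    simp [Density.indicatorIoo, Set.indicator_of_notMem h]

/-- A density of positive total value has an interval of positive value that is worth at most the
fraction `1 / n` of the cake to each of finitely many given densities: the initial `n`-th part of
a cell of a common grid. -/
theorem exists_small_Ioo (hn : 0 < n) {S : Set Density} (hS : S.Finite) {T : Density} (hTS : T ∈ S)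
    (hT : 0 < T.value Set.univ) : ∃ a b : unitInterval, 0 < T.value (Set.Ioo a b) ∧
      ∀ v ∈ S, v.value (Set.Ioo a b) ≤ 1 / (n : ℝ) * v.value Set.univ := by
  obtain ⟨G, hG⟩ := Grid.exists_common hS
  obtain ⟨l, hl⟩ : ∃ l, 0 < T.toFun (G.mid l) := by
    by_contra! h
    rw [G.value_univ (hG T hTS)] at hT
    exact absurd hT (not_lt.2 (Finset.sum_nonpos fun l _ =>
      mul_nonpos_of_nonpos_of_nonneg (h l) (G.len_pos l).le))
  have hn' : (1 : ℝ) ≤ n := by exact_mod_cast hn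
  have hpos := G.len_pos l
  have hle : 1 / (n : ℝ) * G.len l ≤ G.len l :=
    mul_le_of_le_one_left hpos.le ((div_le_one (by linarith)).2 hn')
  have hge : 0 < 1 / (n : ℝ) * G.len l := by positivity
  have hlen : G.len l = (G.x l.succ : ℝ) - G.x l.castSucc := rfl
  let b : unitInterval := ⟨G.x l.castSucc + 1 / (n : ℝ) * G.len l,
    by have := (G.x l.castSucc).2.1; linarith, by have := (G.x l.succ).2.2; linarith⟩
  have hval : ∀ v ∈ S, v.value (Set.Ioo (G.x l.castSucc) b) =
      1 / (n : ℝ) * (v.toFun (G.mid l) * G.len l) := by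
    intro v hv
    have h1 : Set.EqOn v.toFun (fun _ => v.toFun (G.mid l)) (Set.Ioo (G.x l.castSucc) b) :=
      fun y hy => hG v hv l y ⟨hy.1, hy.2.trans_le
        (show (b : ℝ) ≤ G.x l.succ by simp only [b]; linarith)⟩
    rw [Density.value, setIntegral_congr_fun measurableSet_Ioo h1, setIntegral_const,
      measureReal_def, unitInterval.volume_Ioo, show (b : ℝ) - G.x l.castSucc =
        1 / (n : ℝ) * G.len l by simp [b], ENNReal.toReal_ofReal hge.le, smul_eq_mul]
    ring
  refine ⟨G.x l.castSucc, b, ?_, fun v hv => ?_⟩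
  · rw [hval T hTS]; positivity
  · rw [hval v hv]
    exact mul_le_mul_of_nonneg_left (G.value_cell (hG v hv) l) (by positivity)

/-- If agent `j` wants only a small interval that agent `i`, of true density `T`, also wants, then
`i` strictly prefers being first, reporting a multiple of `T`, to `j` being first, whatever the
report of `i` is in that case.  Indeed, a first `j` can take the whole interval, as the other
agents can share the rest proportionally; and if `j` then handed over all but an `n`-th part of
her share to `i`, then `j` would still have a proportional share. -/
theorem exists_density_forall_utility_lt (hn : 2 ≤ n) {i j : Fin n} (hij : i ≠ j)
    (w : Fin n → Density) (X T Y : Density) (hT : 0 < T.value Set.univ) {c : ℝ} (hc : 0 < c)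
    (hY : ∀ x, Y.toFun x = c * T.toFun x) :
    ∃ vbar : Density, (∃ x, vbar.toFun x ≠ 0) ∧
      ∀ vj : Density, (∃ α : ℝ, 0 < α ∧ ∀ x, vj.toFun x = α * vbar.toFun x) →
      ∀ A B : Allocation n,
        IsProportional (Function.update (Function.update w i X) j vj) A →
        (∀ A', IsProportional (Function.update (Function.update w i X) j vj) A' →
          utility j vj A' ≤ utility j vj A) →
        IsProportional (Function.update (Function.update w i Y) j vj) B →
        (∀ B', IsProportional (Function.update (Function.update w i Y) j vj) B' →
          utility i Y B' ≤ utility i Y B) →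
        utility i T A < utility i T B := by
  classical
  have hn2 : (2 : ℝ) ≤ n := by exact_mod_cast hn
  have hn0 : (0 : ℝ) < n := by linarith
  have hn1 : (0 : ℝ) < n - 1 := by linarith
  obtain ⟨a, b, hTab, hsmall⟩ := exists_small_Ioo (n := n) (by omega)
    (((Set.finite_range w).insert X).insert T) (Set.mem_insert T _) hT
  set d := Density.indicatorIoo a b with hd
  refine ⟨d, ?_, ?_⟩
  · by_contra! h
    have : Set.Ioo a b = ∅ := by
      refine Set.eq_empty_of_forall_notMem fun y hy => ?_
      have := h y
      simp [hd, Density.indicatorIoo, Set.indicator_of_mem hy] at this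
    simp [this, Density.value] at hTab
  rintro vj ⟨α, hα, hvj⟩ A B hA hAmax hB hBmax
  obtain ⟨G, hG⟩ := Grid.exists_common ((((Set.finite_range w).insert X).insert T).insert d)
  have hGd : G.Adapted d := hG _ (Set.mem_insert _ _)
  have hGT : G.Adapted T := hG _ (by simp)
  have hGv : G.Adapted vj := fun l y hy => by rw [hvj, hvj, hGd l y hy]
  have hdd : ∀ x, d.toFun x * d.toFun x = d.toFun x := fun x => by
    by_cases hx : x ∈ Set.Ioo a b <;> simp [hd, Density.indicatorIoo, hx]
  have hd1 : ∀ x, d.toFun x ≤ 1 := fun x => by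
    by_cases hx : x ∈ Set.Ioo a b <;> simp [hd, Density.indicatorIoo, hx]
  -- A proportional allocation in which `j` gets the whole interval.
  obtain ⟨A', hA'⟩ := Allocation.exists_amount_eq G
    (fun k l => if k = j then d.toFun (G.mid l) * G.len l else
      (1 - d.toFun (G.mid l)) * G.len l / ((n : ℝ) - 1))
    (fun k l => by
      have h1 := hd1 (G.mid l)
      have h2 := d.nonneg (G.mid l)
      have h3 := G.len_pos l
      split_ifs
      · positivity
      · exact div_nonneg (mul_nonneg (by linarith) h3.le) hn1.le)
    (fun l => by
      rw [← Finset.add_sum_erase _ _ (Finset.mem_univ j), if_pos rfl,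
        Finset.sum_congr rfl fun k hk => if_neg (Finset.ne_of_mem_erase hk), Finset.sum_const,
        Finset.card_erase_of_mem (Finset.mem_univ j), Finset.card_univ, Fintype.card_fin,
        nsmul_eq_mul, Nat.cast_sub (by omega), Nat.cast_one, mul_div_cancel₀ _ hn1.ne']
      apply le_of_eq; ring)
  have hA'j : utility j vj A' = vj.value Set.univ := by
    rw [A'.utility_eq hGv, G.value_univ hGv]
    refine Finset.sum_congr rfl fun l _ => ?_
    rw [hA', if_pos rfl, hvj, ← mul_assoc, mul_assoc α, hdd]
  have hA'k : ∀ k, k ≠ j → ∀ v ∈ insert X (Set.range w),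
      1 / (n : ℝ) * v.value Set.univ ≤ utility k v A' := by
    intro k hk v hv
    have hGv : G.Adapted v := hG v (Or.inr (Or.inr hv))
    have h1 : utility k v A' = (v.value Set.univ - v.value (Set.Ioo a b)) / (n - 1) := by
      rw [A'.utility_eq hGv, G.value_Ioo hGv hGd, G.value_univ hGv, ← Finset.sum_sub_distrib,
        Finset.sum_div]
      refine Finset.sum_congr rfl fun l _ => ?_
      rw [hA', if_neg hk]
      ring
    rw [h1, le_div_iff₀ hn1]
    have h2 := hsmall v (Or.inr hv)
    have h3 : 1 / (n : ℝ) * v.value Set.univ * (n - 1) =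
        v.value Set.univ - 1 / (n : ℝ) * v.value Set.univ := by
      field_simp
    rw [h3]
    linarith
  have hA'prop : IsProportional (Function.update (Function.update w i X) j vj) A' := by
    intro k
    rcases eq_or_ne k j with rfl | hk
    · rw [Function.update_self, hA'j]
      exact mul_le_of_le_one_left (vj.value_nonneg _) ((div_le_one hn0).2 (by linarith))
    · rw [Function.update_of_ne hk]
      refine hA'k k hk _ ?_
      rcases eq_or_ne k i with rfl | hki
      · rw [Function.update_self]; exact Set.mem_insert _ _
      · rw [Function.update_of_ne hki]; exact Or.inr ⟨k, rfl⟩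
  -- Hence `A` gives the whole interval to `j`.
  have hAj : ∀ l, d.toFun (G.mid l) * A.amount G j l = d.toFun (G.mid l) * G.len l := by
    have h1 := hAmax A' hA'prop
    rw [hA'j, utility, Density.value_of_eq_mul hvj, Density.value_of_eq_mul hvj,
      mul_le_mul_iff_right₀ hα] at h1
    change _ ≤ utility j d A at h1
    rw [A.utility_eq hGd, G.value_univ hGd] at h1
    have h2 : ∀ l ∈ Finset.univ, d.toFun (G.mid l) * A.amount G j l ≤
        d.toFun (G.mid l) * G.len l :=
      fun l _ => mul_le_mul_of_nonneg_left (A.amount_le G j l) (d.nonneg _)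
    exact fun l => (Finset.sum_eq_sum_iff_of_le h2).1 (le_antisymm (Finset.sum_le_sum h2) h1) l
      (Finset.mem_univ l)
  have hTA : 0 < utility j T A := by
    refine hTab.trans_le ?_
    rw [G.value_Ioo hGT hGd, A.utility_eq hGT]
    refine Finset.sum_le_sum fun l _ => mul_le_mul_of_nonneg_left ?_ (T.nonneg _)
    rw [← hd, ← hAj]
    exact mul_le_of_le_one_left (A.amount_nonneg G j l) (hd1 _)
  have hYval : ∀ S, Y.value S = c * T.value S := Density.value_of_eq_mul hY
  have hBi : 1 / (n : ℝ) * T.value Set.univ ≤ utility i T B := by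
    have := hB i
    rw [Function.update_of_ne hij, Function.update_self, utility, hYval, hYval,
      mul_left_comm, mul_le_mul_iff_right₀ hc] at this
    exact this
  rcases lt_or_ge (utility i T A) (1 / (n : ℝ) * T.value Set.univ) with hlt | hge
  · exact hlt.trans_le hBi
  -- Otherwise `j` hands over to `i` all but an `n`-th part of her share.
  set θ : ℝ := 1 - 1 / n with hθ
  have hθ1 : 1 / (n : ℝ) ≤ 1 := (div_le_one hn0).2 (by linarith)
  have hθ2 : 1 / (n : ℝ) < 1 := (div_lt_one hn0).2 (by linarith)
  have hθ3 : 0 < 1 / (n : ℝ) := by positivity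
  obtain ⟨B', hB'⟩ := Allocation.exists_amount_eq G
    (fun k l => A.amount G k l + (if k = i then θ * A.amount G j l else 0)
      - (if k = j then θ * A.amount G j l else 0))
    (fun k l => by
      have h0 := A.amount_nonneg G j l
      have h1 := A.amount_nonneg G k l
      rcases eq_or_ne k i with rfl | hki
      · rw [if_pos rfl, if_neg hij, sub_zero]
        exact add_nonneg h1 (mul_nonneg (by linarith) h0)
      · rcases eq_or_ne k j with rfl | hkj
        · rw [if_pos rfl, if_neg hki, hθ, add_zero]
          have : 0 ≤ 1 / (n : ℝ) * A.amount G k l := by positivity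
          linarith
        · rwa [if_neg hki, if_neg hkj, add_zero, sub_zero])
    (fun l => by
      rw [Finset.sum_sub_distrib, Finset.sum_add_distrib, Finset.sum_ite_eq', Finset.sum_ite_eq',
        if_pos (Finset.mem_univ _), if_pos (Finset.mem_univ _), add_sub_cancel_right]
      exact A.sum_amount_le G l)
  have hB'i : utility i T B' = utility i T A + θ * utility j T A := by
    rw [B'.utility_eq hGT, A.utility_eq hGT, A.utility_eq hGT, Finset.mul_sum,
      ← Finset.sum_add_distrib]
    refine Finset.sum_congr rfl fun l _ => ?_
    rw [hB', if_pos rfl, if_neg hij]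
    ring
  have hgain : utility i T A < utility i T B' := by
    rw [hB'i]
    have : 0 < θ * utility j T A := mul_pos (by linarith) hTA
    linarith
  have hB'prop : IsProportional (Function.update (Function.update w i Y) j vj) B' := by
    intro k
    rcases eq_or_ne k j with rfl | hkj
    · have h1 : utility k vj B' = 1 / (n : ℝ) * utility k vj A := by
        rw [B'.utility_eq hGv, A.utility_eq hGv, Finset.mul_sum]
        refine Finset.sum_congr rfl fun l _ => ?_
        rw [hB', if_pos rfl, if_neg hij.symm]
        ring
      rw [Function.update_self, h1]
      exact mul_le_mul_of_nonneg_left (hA'j ▸ hAmax A' hA'prop) hθ3.le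
    · rw [Function.update_of_ne hkj]
      rcases eq_or_ne k i with rfl | hki
      · rw [Function.update_self, utility, hYval, hYval, mul_left_comm, mul_le_mul_iff_right₀ hc]
        exact hge.trans hgain.le
      · have h1 := hA k
        rw [Function.update_of_ne hkj, Function.update_of_ne hki] at h1
        rw [Function.update_of_ne hki]
        refine h1.trans (le_of_eq ?_)
        have hGk : G.Adapted (w k) := hG _ (Or.inr (Or.inr (Or.inr ⟨k, rfl⟩)))
        rw [B'.utility_eq hGk, A.utility_eq hGk]
        refine Finset.sum_congr rfl fun l _ => ?_
        rw [hB', if_neg hki, if_neg hkj, add_zero, sub_zero]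
  have hfin := hBmax B' hB'prop
  rw [utility, utility, hYval, hYval, mul_le_mul_iff_right₀ hc] at hfin
  exact hgain.trans_le hfin

/-! ### The RAT-degree under a volatile priority rule -/

/-- Under a volatile rule, some report of `j` puts `j` first if `i` reports `X`, and `i` first if
`i` reports a multiple `Y` of her true density, so that `i` strictly prefers to report `Y`. -/
theorem IsVolatile.exists_utility_lt {Γ : PriorityRule n} (hΓ : IsVolatile Γ)
    {f : (Fin n → Density) → Allocation n} (hf : IsPriorityMechanism Γ f) (hn : 2 ≤ n)
    {i j : Fin n} (hij : i ≠ j) (w : Fin n → Density) {X T Y : Density} (hXY : X ≠ Y)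
    (hT : 0 < T.value Set.univ) {c : ℝ} (hc : 0 < c) (hY : ∀ x, Y.toFun x = c * T.toFun x) :
    ∃ vj, utility i T (f (Function.update (Function.update w j vj) i X)) <
      utility i T (f (Function.update (Function.update w j vj) i Y)) := by
  have hn0 : 0 < n := by omega
  obtain ⟨vbar, hne, H⟩ := exists_density_forall_utility_lt hn hij w X T Y hT hc hY
  obtain ⟨vj, hvj, hj, hi⟩ := hΓ i j hij (Equiv.swap ⟨0, hn0⟩ j) (Equiv.swap ⟨0, hn0⟩ i) w vbar
    hne X Y hXY
  refine ⟨vj, ?_⟩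
  rw [Function.update_comm hij.symm, Function.update_comm hij.symm]
  have hX := hf (Function.update (Function.update w i X) j vj)
  have hY := hf (Function.update (Function.update w i Y) j vj)
  refine H vj hvj _ _ (isProportional_of_mem_leximaxStage hX) (fun A' hA' => ?_)
    (isProportional_of_mem_leximaxStage hY) (fun B' hB' => ?_)
  · simpa using utility_le_of_first hn0 (i := j) (by rw [hj, Equiv.swap_apply_left]) hX hA'
  · simpa [Function.update_of_ne hij] using
      utility_le_of_first hn0 (i := i) (by rw [hi, Equiv.swap_apply_left]) hY hB'

/-- An unknown agent `j` can arrange that the truthful report of `i` puts `i` first, and her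
misreport puts `j` first. -/
theorem not_safelyManipulable {Γ : PriorityRule n} (hΓ : IsVolatile Γ)
    {f : (Fin n → Density) → Allocation n} (hf : IsPriorityMechanism Γ f) (hn : 2 ≤ n) {k : ℕ}
    (hk : k < n - 1) : ¬ RAT.SafelyManipulable utility f k := by
  classical
  rintro ⟨i, K, hiK, hK, PK, T, P, hPT, ⟨Q₀, -, hlt⟩, hsafe⟩
  -- The manipulation is profitable for some reports, so `T` does not vanish.
  have hT : 0 < T.value Set.univ :=
    (T.value_nonneg _).trans_lt (hlt.trans_le (T.value_le_univ _))
  obtain ⟨j, hj⟩ : ∃ j, j ∉ insert i K := by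
    by_contra! h
    have h1 := Finset.card_insert_of_notMem hiK
    rw [Finset.eq_univ_of_forall h, Finset.card_univ, Fintype.card_fin] at h1
    omega
  rw [Finset.mem_insert, not_or] at hj
  obtain ⟨vj, hvj⟩ := hΓ.exists_utility_lt hf hn (Ne.symm hj.1)
    (fun k => if h : k ∈ K then PK ⟨k, h⟩ else T) hPT hT one_pos (fun x => (one_mul _).symm)
  refine absurd (hsafe _ fun k => ?_) (not_le.2 hvj)
  have hkj : (k : Fin n) ≠ j := fun h => hj.2 (h ▸ k.2)
  simp [Function.update_of_ne hkj]

/-- Knowing all other reports, an agent with a uniform density manipulates by doubling her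
density. -/
theorem safelyManipulable_pred {Γ : PriorityRule n} (hΓ : IsVolatile Γ)
    {f : (Fin n → Density) → Allocation n} (hf : IsPriorityMechanism Γ f) (hn : 2 ≤ n) :
    RAT.SafelyManipulable utility f (n - 1) := by
  classical
  let i : Fin n := ⟨0, by omega⟩
  let j : Fin n := ⟨1, by omega⟩
  have hij : i ≠ j := by simp [i, j, Fin.ext_iff]
  let T : Density := .const 1 zero_le_one
  let P : Density := .const 2 zero_le_two
  have hTP : T ≠ P := fun h => by
    have := congrArg (fun v : Density => v.toFun 0) h
    simp [T, P, Density.const] at this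
  have hT : 0 < T.value Set.univ := by simp [T, Density.const, Density.value]
  obtain ⟨vj, hvj⟩ := hΓ.exists_utility_lt hf hn hij (fun _ => T) hTP hT two_pos
    (fun x => by simp [T, P, Density.const])
  refine ⟨i, Finset.univ.erase i, Finset.notMem_erase _ _, ?_,
    fun k => Function.update (fun _ => T) j vj k, T, P, hTP.symm, ⟨_, fun _ => rfl, hvj⟩, ?_⟩
  · rw [Finset.card_erase_of_mem (Finset.mem_univ i), Finset.card_univ, Fintype.card_fin]
  · intro Q hQ
    have : ∀ R : Density, Function.update Q i R =
        Function.update (Function.update (fun _ => T) j vj) i R := by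
      intro R
      funext k
      rcases eq_or_ne k i with rfl | hk
      · simp
      · rw [Function.update_of_ne hk, Function.update_of_ne hk]
        exact hQ ⟨k, Finset.mem_erase.2 ⟨hk, Finset.mem_univ k⟩⟩
    rw [this, this]
    exact hvj.le

theorem ratDegree_eq {Γ : PriorityRule n} (hΓ : IsVolatile Γ)
    {f : (Fin n → Density) → Allocation n} (hf : IsPriorityMechanism Γ f) (hn : 2 ≤ n) :
    RAT.ratDegree utility f = n - 1 := by
  classical
  have h := safelyManipulable_pred hΓ hf hn
  rw [RAT.ratDegree, dif_pos ⟨_, h⟩]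
  exact (Nat.find_eq_iff _).2 ⟨h, fun k hk => not_safelyManipulable hΓ hf hn hk⟩

/-! ### A volatile priority rule -/

/-- The maximum of a density. -/
noncomputable def Density.sup (v : Density) : ℝ := ⨆ x, v.toFun x

theorem Density.bddAbove (v : Density) : BddAbove (Set.range v.toFun) := by
  obtain ⟨G, hG⟩ := Grid.exists_adapted v
  refine Set.Finite.bddAbove (Set.Finite.subset
    (((Set.finite_range G.x).union (Set.finite_range G.mid)).image v.toFun) ?_)
  rintro _ ⟨y, rfl⟩
  by_cases hy : y ∈ Set.range G.x
  · exact ⟨y, Or.inl hy, rfl⟩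
  · obtain ⟨l, hl⟩ := G.exists_mem_cell hy
    exact ⟨G.mid l, Or.inr ⟨l, rfl⟩, (hG l y hl).symm⟩

theorem Density.sup_nonneg (v : Density) : 0 ≤ v.sup := Real.iSup_nonneg v.nonneg

theorem Density.sup_pos {v : Density} (hv : ∃ x, v.toFun x ≠ 0) : 0 < v.sup := by
  obtain ⟨x, hx⟩ := hv
  exact ((v.nonneg x).lt_of_ne' hx).trans_le (le_ciSup v.bddAbove x)

theorem Density.exists_sup_eq {v : Density} (hv : ∃ x, v.toFun x ≠ 0) {m : ℝ} (hm : 0 < m) :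
    ∃ w : Density, (∃ α : ℝ, 0 < α ∧ ∀ x, w.toFun x = α * v.toFun x) ∧ w.sup = m := by
  have hpos := Density.sup_pos hv
  have hα : 0 < m / v.sup := div_pos hm hpos
  refine ⟨⟨fun x => m / v.sup * v.toFun x, fun x => mul_nonneg hα.le (v.nonneg x), ?_⟩,
    ⟨_, hα, fun _ => rfl⟩, ?_⟩
  · obtain ⟨k, x, hx, h0, h1, hc⟩ := v.piecewiseConstant
    refine ⟨k, x, hx, h0, h1, fun l => ?_⟩
    obtain ⟨c, hc⟩ := hc l
    exact ⟨m / v.sup * c, fun y hy => congrArg _ (hc y hy)⟩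
  · rw [Density.sup, ← Real.mul_iSup_of_nonneg hα.le]
    exact div_mul_cancel₀ m hpos.ne'

/-- A density is determined by its restrictions to the points of a grid to which it is adapted and
to a countable dense set, so there are at most continuum many densities. -/
theorem exists_injective_density : ∃ g : Density → ℝ, Function.Injective g := by
  classical
  obtain ⟨D, hDc, hDd⟩ := TopologicalSpace.exists_countable_dense unitInterval
  choose G hG using Grid.exists_adapted
  have hcode : Function.Injective (fun v : Density =>
      ((Finset.univ.image fun k => (((G v).x k : ℝ), v.toFun ((G v).x k)) : Finset (ℝ × ℝ)),
        (fun q : D => v.toFun q))) := by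
    intro v w h
    obtain ⟨h1, h2⟩ := Prod.mk.inj h
    have hgraph : ∀ k, ∃ k', (G w).x k' = (G v).x k ∧
        w.toFun ((G w).x k') = v.toFun ((G v).x k) := by
      intro k
      have : (((G v).x k : ℝ), v.toFun ((G v).x k)) ∈
          Finset.univ.image fun k => (((G w).x k : ℝ), w.toFun ((G w).x k)) := by
        rw [← h1]; exact Finset.mem_image_of_mem _ (Finset.mem_univ k)
      obtain ⟨k', -, hk'⟩ := Finset.mem_image.1 this
      obtain ⟨e1, e2⟩ := Prod.mk.inj hk'
      exact ⟨k', Subtype.ext e1, e2⟩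
    have hsub : Set.range (G v).x ⊆ Set.range (G w).x := by
      rintro _ ⟨k, rfl⟩
      obtain ⟨k', hk', -⟩ := hgraph k
      exact ⟨k', hk'⟩
    have hvw : (G w).Adapted v := (hG v).mono hsub
    suffices v.toFun = w.toFun by cases v; cases w; simpa using this
    funext y
    by_cases hy : y ∈ Set.range (G v).x
    · obtain ⟨k, rfl⟩ := hy
      obtain ⟨k', e1, e2⟩ := hgraph k
      rw [← e2, e1]
    by_cases hy' : y ∈ Set.range (G w).x
    · obtain ⟨k, rfl⟩ := hy'
      have : (((G w).x k : ℝ), w.toFun ((G w).x k)) ∈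
          Finset.univ.image fun k => (((G v).x k : ℝ), v.toFun ((G v).x k)) := by
        rw [h1]; exact Finset.mem_image_of_mem _ (Finset.mem_univ k)
      obtain ⟨k', -, hk'⟩ := Finset.mem_image.1 this
      exact absurd ⟨k', Subtype.ext (Prod.mk.inj hk').1⟩ hy
    · obtain ⟨l, hl⟩ := (G w).exists_mem_cell hy'
      obtain ⟨q, hq, hqD⟩ := hDd.inter_open_nonempty _ isOpen_Ioo ((G w).cell_nonempty l)
      rw [hvw l y hl, hG w l y hl, ← hvw l q hq, ← hG w l q hq]
      exact congrFun h2 ⟨q, hqD⟩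
  have hcard : Cardinal.mk (Finset (ℝ × ℝ) × (D → ℝ)) ≤ Cardinal.mk ℝ := by
    have : Countable D := hDc.to_subtype
    rw [Cardinal.mk_prod, Cardinal.lift_id, Cardinal.lift_id, Cardinal.mk_finset_of_infinite,
      Cardinal.mk_prod, Cardinal.lift_id, Cardinal.mk_arrow, Cardinal.lift_id, Cardinal.lift_id,
      Cardinal.mk_real, Cardinal.continuum_mul_self]
    calc Cardinal.continuum * Cardinal.continuum ^ Cardinal.mk D
        ≤ Cardinal.continuum * Cardinal.continuum ^ Cardinal.aleph0 :=
          mul_le_mul_right (Cardinal.power_le_power_left Cardinal.continuum_ne_zero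
            (Cardinal.mk_le_aleph0)) _
      _ = Cardinal.continuum := by
          rw [Cardinal.continuum_power_aleph0, Cardinal.continuum_mul_self]
  obtain ⟨e⟩ := Cardinal.le_def _ _ |>.1 hcard
  exact ⟨_, e.injective.comp hcode⟩

/-- The rule: the agent whose report has the strictly largest maximum announces, by the integer
part of this maximum, an agent `i`, a rational threshold, and two orders, one for each side of the
threshold on which the real number that encodes the report of `i` may lie. -/
theorem exists_isVolatile (n : ℕ) : ∃ Γ : PriorityRule n, IsVolatile Γ := by
  classical
  rcases Nat.eq_zero_or_pos n with rfl | hn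
  · exact ⟨fun _ => 1, fun i => i.elim0⟩
  obtain ⟨g, hg⟩ := exists_injective_density
  have : Nonempty (Fin n) := ⟨⟨0, hn⟩⟩
  obtain ⟨e, he⟩ := exists_surjective_nat
    (Fin n × ℚ × Equiv.Perm (Fin n) × Equiv.Perm (Fin n))
  let rule : Fin n × ℚ × Equiv.Perm (Fin n) × Equiv.Perm (Fin n) → PriorityRule n :=
    fun t v => if g (v t.1) < t.2.1 then t.2.2.1 else t.2.2.2
  let Γ : PriorityRule n := fun v =>
    if h : ∃ j, ∀ k, k ≠ j → (v k).sup < (v j).sup then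
      rule (e (Nat.unpair ⌊(v h.choose).sup⌋₊).1) v else 1
  have hΓ : ∀ (v : Fin n → Density) (j : Fin n) (s b : ℕ), (v j).sup = Nat.pair s b →
      (∀ k, k ≠ j → (v k).sup < Nat.pair s b) → Γ v = rule (e s) v := by
    intro v j s b hj hk
    have h : ∃ j, ∀ k, k ≠ j → (v k).sup < (v j).sup := ⟨j, fun k hkj => hj ▸ hk k hkj⟩
    have hch : h.choose = j := by
      by_contra hne
      have h1 := h.choose_spec j (Ne.symm hne)
      have h2 := hk _ hne
      rw [← hj] at h2
      exact lt_asymm h1 h2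
    simp only [Γ]
    rw [dif_pos h, hch, hj, Nat.floor_natCast, Nat.unpair_pair]
  refine ⟨Γ, fun i j hij π π' w vbar hvbar vi vi' hne => ?_⟩
  -- A threshold that separates the codes of the two reports of `i`.
  obtain ⟨q, π₁, π₂, hq, hq'⟩ : ∃ (q : ℚ) (π₁ π₂ : Equiv.Perm (Fin n)),
      (if g vi < q then π₁ else π₂) = π ∧ (if g vi' < q then π₁ else π₂) = π' := by
    rcases lt_or_gt_of_ne (hg.ne hne) with h | h
    · obtain ⟨q, h1, h2⟩ := exists_rat_btwn h
      exact ⟨q, π, π', if_pos h1, if_neg h2.le.not_gt⟩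
    · obtain ⟨q, h1, h2⟩ := exists_rat_btwn h
      exact ⟨q, π', π, if_neg h2.le.not_gt, if_pos h1⟩
  obtain ⟨s, hs⟩ := he (i, q, π₁, π₂)
  -- Padding by a large `b` makes the maximum of `j` the strictly largest one.
  obtain ⟨b, hb⟩ := exists_nat_gt (∑ k, (w k).sup + vi.sup + vi'.sup)
  have hbig : ∑ k, (w k).sup + vi.sup + vi'.sup < (Nat.pair s b : ℝ) :=
    hb.trans_le (by exact_mod_cast Nat.right_le_pair s b)
  have hsum : 0 ≤ ∑ k, (w k).sup := Finset.sum_nonneg fun k _ => (w k).sup_nonneg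
  have h1 := vi.sup_nonneg
  have h2 := vi'.sup_nonneg
  obtain ⟨vj, hvj, hsup⟩ := Density.exists_sup_eq hvbar
    (show (0 : ℝ) < Nat.pair s b by linarith)
  have key : ∀ u : Density, u.sup < Nat.pair s b →
      Γ (Function.update (Function.update w i u) j vj) = if g u < q then π₁ else π₂ := by
    intro u hu
    rw [hΓ _ j s b (by rw [Function.update_self, hsup]), hs]
    · simp [rule, Function.update_of_ne hij]
    · intro k hk
      rw [Function.update_of_ne hk]
      rcases eq_or_ne k i with rfl | hki
      · rwa [Function.update_self]
      · rw [Function.update_of_ne hki]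
        have := Finset.single_le_sum (f := fun k => (w k).sup) (fun k _ => (w k).sup_nonneg)
          (Finset.mem_univ k)
        linarith
  exact ⟨vj, hvj, (key vi (by linarith)).trans hq, (key vi' (by linarith)).trans hq'⟩

end Cake

theorem mainTheorem7 (n : ℕ) :
    (∃ Γ : Cake.PriorityRule n, Cake.IsVolatile Γ) ∧
    ∀ Γ : Cake.PriorityRule n,
      (∃ f : (Fin n → Cake.Density) → Cake.Allocation n, Cake.IsPriorityMechanism Γ f) ∧
      ∀ f : (Fin n → Cake.Density) → Cake.Allocation n, Cake.IsPriorityMechanism Γ f →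
        (∀ v, Cake.IsProportional v (f v) ∧ Cake.IsParetoOptimal v (f v)) ∧
        (Cake.IsVolatile Γ → 2 ≤ n → RAT.ratDegree Cake.utility f = n - 1) := by
  refine ⟨Cake.exists_isVolatile n, fun Γ => ⟨Cake.exists_isPriorityMechanism Γ, fun f hf => ?_⟩⟩
  exact ⟨fun v => ⟨Cake.isProportional_of_mem_leximaxStage (hf v),
    Cake.isParetoOptimal_of_mem_leximaxStage (hf v)⟩, fun hΓ hn => Cake.ratDegree_eq hΓ hf hn⟩
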